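/- Let $H$ be a finite connected graph, possibly with multiple edges but without loops, with vertices $v_1,\dots,v_m$, let $a_{ij}$ be the number of edges between $v_i$ and $v_j$ and $d_i=\sum_j a_{ij}$ the degree of $v_i$. For every $i$ let $1\le s_{i,1}<s_{i,2}<\dots<s_{i,k_i}$ be integers, where $k_i=0$ is allowed. For $n\ge 1$ let $H_n$ be the circulant foliation over $H$ whose fiber over $v_i$ is the circulant graph $C_n(s_{i,1},\dots,s_{i,k_i})$: its vertices are the pairs $(k,v_i)$ with $k\in\mathbb{Z}/n\mathbb{Z}$ and $1\le i\le m$; for every $k$ and $i\ne j$ the vertices $(k,v_i)$ and $(k,v_j)$ are joined by $a_{ij}$ edges; and for every $k$, $i$ and $1\le j\le k_i$ there is one edge joining $(k,v_i)$ to $(k+s_{i,j},v_i)$ (multiple edges are allowed, for instance two edges between $(k,v_i)$ and $(k+s_{i,j},v_i)$ if $n=2s_{i,j}$, and so are loops if $n\mid s_{i,j}$). Let $\tau(H)$ and $\tau(n)$ be the numbers of spanning trees of $H$ and of $H_n$. Let $T_s$ denote the Chebyshev polynomial of the first kind, and let $$Q(w)=\det\bigl(\operatorname{diag}(w_1,\dots,w_m)-(a_{ij})_{i,j=1}^m\bigr),\qquad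 w_i=2k_i+d_i-\sum_{j=1}^{k_i}2\,T_{s_{i,j}}(w),$$ which is a polynomial in $w$ with integer coefficients. Then $Q(-1)\ge 0$, with equality if and only if all $s_{i,j}$ are even. Let $p$ be the square-free part of $Q(-1)$, that is, the square-free positive integer with $Q(-1)=p\,r^2$ for some integer $r\ge 0$ (it is unique if $Q(-1)>0$; if $Q(-1)=0$, let $p$ be any square-free positive integer). Then there is a sequence of integers $a(n)$, $n\ge 1$, such that $$\tau(n)=n\,\tau(H)\,a(n)^2\ \text{ for every odd } n\ge 1,\qquad \tau(n)=p\,n\,\tau(H)\,a(n)^2\ \text{ for every even } n\ge 2.$$ -/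

import Mathlib

open scoped Graph

namespace Foliation

/-- The number of edges of the multigraph `G` between `u` and `v`. -/
noncomputable def edgeMult {V E : Type*} (G : Graph V E) (u v : V) : ℕ :=
  {e : E | G.IsLink e u v}.ncard

/-- The degree of `u` in a loopless multigraph `G`: the sum of the edge multiplicities at `u`. -/
noncomputable def degree {V E : Type*} (G : Graph V E) [Fintype V(G)] (u : V) : ℕ :=
  ∑ v : V(G), edgeMult G u v

/-- A spanning tree of a multigraph `G`: a subgraph with the same vertex set that has no loops and
no parallel edges and is a tree. -/
def IsSpanningTree {V E : Type*} (G T : Graph V E) : Prop :=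
  T.IsSpanningSubgraph G ∧ T.Simple ∧ T.toSimpleGraph.IsTree

/-- The complexity of a finite multigraph `G`: the number of its spanning trees. -/
noncomputable def complexity {V E : Type*} (G : Graph V E) : ℕ :=
  {T : Graph V E | IsSpanningTree G T}.ncard

/-- The circulant foliation over the multigraph `H` with fibers the circulant graphs on `n` vertices
with jump sets `S v`, `v ∈ V(H)`.
The vertices are the pairs `(k, v)` with `k ∈ ℤ/n` and `v ∈ V(H)`. The edges are
* for every `k` and every edge `e` of `H` with ends `u, v`, an edge between `(k, u)` and `(k, v)`;
* for every `k`, every `v ∈ V(H)` and every `s ∈ S v`, an edge between `(k, v)` and `(k + s, v)`.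
In particular, for `n = 2 * s` there are two edges between `(k, v)` and `(k + s, v)`. -/
def foliation {V E : Type*} (H : Graph V E) (S : V → Finset ℕ) (n : ℕ) :
    Graph (ZMod n × V) (ZMod n × (E ⊕ V × ℕ)) where
  vertexSet := {x | x.2 ∈ V(H)}
  IsLink f x y := match f with
    | (k, Sum.inl e) => x.1 = k ∧ y.1 = k ∧ H.IsLink e x.2 y.2
    | (k, Sum.inr (v, s)) => v ∈ V(H) ∧ s ∈ S v ∧
        ((x = (k, v) ∧ y = (k + (s : ZMod n), v)) ∨ (x = (k + (s : ZMod n), v) ∧ y = (k, v)))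
  isLink_symm := by
    rintro ⟨k, e | ⟨v, s⟩⟩ -
    · exact ⟨fun x y h => ⟨h.2.1, h.1, h.2.2.symm⟩⟩
    · refine ⟨fun x y h => ⟨h.1, h.2.1, ?_⟩⟩
      rcases h.2.2 with h | h
      · exact Or.inr ⟨h.2, h.1⟩
      · exact Or.inl ⟨h.2, h.1⟩
  eq_or_eq_of_isLink_of_isLink := by
    rintro ⟨k, e | ⟨v, s⟩⟩ x y z w h h'
    · rcases h.2.2.left_eq_or_eq h'.2.2 with h2 | h2
      · exact Or.inl (Prod.ext (h.1.trans h'.1.symm) h2)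
      · exact Or.inr (Prod.ext (h.1.trans h'.2.1.symm) h2)
    · rcases h.2.2 with ⟨rfl, rfl⟩ | ⟨rfl, rfl⟩ <;> rcases h'.2.2 with ⟨rfl, rfl⟩ | ⟨rfl, rfl⟩ <;>
        simp
  left_mem_of_isLink := by
    rintro ⟨k, e | ⟨v, s⟩⟩ x y h
    · exact h.2.2.left_mem
    · rcases h.2.2 with ⟨rfl, -⟩ | ⟨rfl, -⟩ <;> exact h.1

/-- The generalized Laplacian matrix of `H`: the diagonal matrix of the variables `x` minus the
adjacency matrix of `H`. -/
noncomputable def genLaplacian {V E R : Type*} [CommRing R] [DecidableEq V] (H : Graph V E)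
    (x : V(H) → R) : Matrix V(H) V(H) R :=
  Matrix.diagonal x - Matrix.of fun u v : V(H) => (edgeMult H u v : R)

/-- The polynomial `Q(w) = det L(H, W)` with
`W v = 2 * k_v + d_v - ∑ s ∈ S v, 2 * T_s(w)`, where `k_v` is the number of jumps and `d_v` the
degree at `v`, and `T_s` is the Chebyshev polynomial of the first kind. -/
noncomputable def chebyshevPoly {V E : Type*} [DecidableEq V] (H : Graph V E) [Fintype V(H)]
    (S : V → Finset ℕ) : Polynomial ℤ :=
  (genLaplacian H fun v : V(H) =>
    (2 * ((S v).card : Polynomial ℤ) + (degree H (v : V) : Polynomial ℤ)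
      - ∑ s ∈ S v, 2 * Polynomial.Chebyshev.T ℤ (s : ℤ))).det

end Foliation

/-! ### Cauchy-Binet and divisibility of determinants -/

namespace Matrix

/-! Let m be the number of vertices of H, J an all-ones matrix, and P = `scaledPoly H S`, so Q(w) =
P(2w). Cauchy-Binet applied to the incidence matrix bordered by a column of ones gives the
matrix-tree theorem in the form det(L + J) = (number of vertices)² · τ
(`det_incidence_eq_complexity`). A Fourier transform along the fibers splits L(H_n) + J into blocks
indexed by j mod n (`det_foliation_laplacian_add`). For j ≠ 0 the block has determinant P(x_j) with
x_j = 2cos(2πj/n); the block at 0 is L(H) + nJ, of determinant n m² τ(H). Hence n τ(n) = τ(H)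
∏_{j≠0} P(x_j) (`natCast_mul_complexity_foliation`).

As P(2) = det L(H) = 0, P = (X - 2)g with g integral, and ∏ (x_j - 2) = ±n². Because x_j = x_{-j},
the values g(x_j) pair off, except at x_{n/2} = -2 when n is even. So ∏ g(x_j) is the square of a
resultant, hence of an integer, times g(-2) for even n; the integral square root comes from the
factorization of C_n - 2 (`chebyshevC_sub_two`). Finally Q(-1) = -4g(-2), which gives -g(-2) = p q².

The sign of Q(-1) and the case Q(-1) = 0 follow because P(-2) is the determinant of L(H) plus a
nonnegative diagonal matrix. -/

theorem det_mul_eq_sum_prod_mul_det {n κ R : Type*} [Fintype n] [DecidableEq n] [Fintype κ]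
    [DecidableEq κ] [CommRing R] (A : Matrix n κ R) (B : Matrix κ n R) :
    (A * B).det = ∑ f : n → κ, (∏ i, A i (f i)) * (B.submatrix f id).det := by
  have h : A * B = fun i => ∑ k, A i k • B k := by
    ext i j
    simp [Matrix.mul_apply]
  have h2 : (A * B).det = detRowAlternating.toMultilinearMap (fun i => ∑ k, A i k • B k) := by
    rw [← h]; rfl
  rw [h2, MultilinearMap.map_sum]
  refine Finset.sum_congr rfl fun f _ => ?_
  rw [MultilinearMap.map_smul_univ]
  rfl

/-- The Cauchy-Binet formula, summed over all maps instead of all subsets of columns. -/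
theorem factorial_mul_det_mul {n κ R : Type*} [Fintype n] [DecidableEq n] [Fintype κ]
    [DecidableEq κ] [CommRing R] (A : Matrix n κ R) (B : Matrix κ n R) :
    ((Fintype.card n).factorial : R) * (A * B).det =
      ∑ f : n → κ, (A.submatrix id f).det * (B.submatrix f id).det := by
  -- Reindexing f by σ permutes the rows of the minor of B and costs sign σ. Summing over all σ then
  -- assembles the determinant of the minor of A.
  have key : ∀ σ : Equiv.Perm n, (A * B).det =
      ∑ f : n → κ, ((Equiv.Perm.sign σ : ℤ) : R) * (∏ i, A i (f (σ i))) *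
        (B.submatrix f id).det := by
    intro σ
    rw [det_mul_eq_sum_prod_mul_det]
    refine Fintype.sum_equiv (Equiv.arrowCongr σ (Equiv.refl κ)) _ _ fun f => ?_
    have h : B.submatrix f id =
        (B.submatrix (Equiv.arrowCongr σ (Equiv.refl κ) f) id).submatrix σ id := by
      ext i j
      simp [Equiv.arrowCongr]
    rw [h, det_permute]
    simp only [Equiv.arrowCongr_apply, Equiv.coe_refl, Function.comp_apply, id_eq,
      Equiv.symm_apply_apply]
    ring
  calc ((Fintype.card n).factorial : R) * (A * B).det
      = ∑ σ : Equiv.Perm n, (A * B).det := by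
        rw [Finset.sum_const, Finset.card_univ, Fintype.card_perm, nsmul_eq_mul]
    _ = ∑ σ : Equiv.Perm n, ∑ f : n → κ, ((Equiv.Perm.sign σ : ℤ) : R) *
          (∏ i, A i (f (σ i))) * (B.submatrix f id).det := Finset.sum_congr rfl fun σ _ => key σ
    _ = _ := by
        rw [Finset.sum_comm]
        refine Finset.sum_congr rfl fun f _ => ?_
        rw [← Finset.sum_mul]
        congr 1
        rw [← det_transpose (A.submatrix id f), det_apply']
        rfl

/-- The hypothesis says B = A X for some X over R. Used in both directions, it compares determinants
of two bases of one lattice up to sign. -/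
theorem det_dvd_det_of_mem_range {n R : Type*} [Fintype n] [DecidableEq n] [CommRing R]
    (A B : Matrix n n R) (h : ∀ j, (fun i => B i j) ∈ LinearMap.range A.mulVecLin) :
    A.det ∣ B.det := by
  choose x hx using h
  have : B = A * Matrix.of fun i j => x j i := by
    ext i j
    have := congrFun (hx j) i
    simpa [Matrix.mul_apply, Matrix.mulVec, dotProduct] using this.symm
  rw [this, det_mul]
  exact dvd_mul_right _ _

end Matrix

/-! ### Matrix-tree theorem for connecting edge sets -/

namespace Foliation

variable {ι κ : Type*}

/-- The edges in `F` with sources `s` and targets `t` connect all vertices. -/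
def Connects (s t : κ → ι) (F : Set κ) : Prop :=
  ∀ x y, Relation.EqvGen (fun a b => ∃ e ∈ F, s e = a ∧ t e = b) x y

/-- The oriented incidence matrix of a multigraph. -/
def incidence [DecidableEq ι] (R : Type*) [Ring R] (s t : κ → ι) : Matrix ι κ R :=
  Matrix.of fun v e => Pi.single (M := fun _ => R) (s e) 1 v - Pi.single (M := fun _ => R) (t e) 1 v

/-- The oriented incidence matrix, extended by a column of ones. -/
def bordered [DecidableEq ι] (s t : κ → ι) : Matrix ι (Option κ) ℤ :=
  Matrix.of fun v e => e.elim 1 fun e => incidence ℤ s t v e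

theorem bordered_mul_transpose [DecidableEq ι] [Fintype κ] (s t : κ → ι) :
    bordered s t * (bordered s t).transpose =
      incidence ℤ s t * (incidence ℤ s t).transpose + Matrix.of fun _ _ => 1 := by
  ext i j
  simp [Matrix.mul_apply, Fintype.sum_option, bordered, add_comm]

section

variable [Fintype ι] [DecidableEq ι]

theorem sum_incidence (s t : κ → ι) (e : κ) : ∑ v, incidence ℤ s t v e = 0 := by
  simp [incidence]

theorem connects_of_det_ne_zero (s t : κ → ι) (f : ι → Option κ)
    (h : ((bordered s t).submatrix id f).det ≠ 0) :
    Connects s t {e | some e ∈ Set.range f} := by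
  classical
  by_contra hc
  simp only [Connects, not_forall] at hc
  obtain ⟨x, y, hxy⟩ := hc
  apply h
  rw [← Matrix.exists_vecMul_eq_zero_iff]
  set R : ι → ι → Prop := Relation.EqvGen
    (fun a b => ∃ e ∈ {e | some e ∈ Set.range f}, s e = a ∧ t e = b) with hR
  set g : ι → ℤ := fun v => if R x v then 1 else 0 with hg
  have hgst : ∀ e, some e ∈ Set.range f → g (s e) = g (t e) := by
    intro e he
    have h1 : R (s e) (t e) := Relation.EqvGen.rel _ _ ⟨e, he, rfl, rfl⟩
    have : R x (s e) ↔ R x (t e) := ⟨fun h => h.trans _ _ _ h1, fun h => h.trans _ _ _ (h1.symm _ _)⟩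
    simp [hg, this]
  -- The indicator g of the component of x, scaled by the number of vertices and shifted to have sum
  -- zero. It is constant along each chosen edge and orthogonal to the column of ones, so it is a
  -- left kernel vector.
  refine ⟨fun v => Fintype.card ι * g v - ∑ w, g w, fun h0 => ?_, ?_⟩
  · have hx := congrFun h0 x
    have hy := congrFun h0 y
    have gx : g x = 1 := if_pos (Relation.EqvGen.refl x)
    have gy : g y = 0 := if_neg hxy
    have : 0 < Fintype.card ι := Fintype.card_pos_iff.2 ⟨x⟩
    simp only [gx, gy, Pi.zero_apply] at hx hy
    omega
  · ext j
    simp only [Matrix.vecMul, dotProduct, Matrix.submatrix_apply, id_eq, Pi.zero_apply]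
    rcases hfj : f j with _ | e
    · simp [bordered, Finset.sum_sub_distrib, ← Finset.mul_sum]
    · have := hgst e ⟨j, hfj⟩
      simp [bordered, incidence, mul_sub, Finset.sum_sub_distrib, Pi.single_apply, this]

theorem none_mem_range_of_det_ne_zero [Nonempty ι] (s t : κ → ι) (f : ι → Option κ)
    (h : ((bordered s t).submatrix id f).det ≠ 0) : none ∈ Set.range f := by
  by_contra hc
  apply h
  rw [← Matrix.exists_vecMul_eq_zero_iff]
  refine ⟨1, one_ne_zero, ?_⟩
  ext j
  rcases hfj : f j with _ | e
  · exact absurd ⟨j, hfj⟩ hc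
  · simp [Matrix.vecMul, dotProduct, hfj, bordered, sum_incidence]

theorem injective_of_det_ne_zero (s t : κ → ι) (f : ι → Option κ)
    (h : ((bordered s t).submatrix id f).det ≠ 0) : Function.Injective f := by
  intro i j hij
  by_contra hne
  exact h (Matrix.det_zero_of_column_eq hne fun k => by simp [hij])

/-- Connecting edges generate all differences of basis vectors. Together with the vector of ones
they span the lattice of integer vectors whose coordinate sum is divisible by m = `Fintype.card ι`,
which has index m. -/
theorem det_sq_of_connects [Nonempty ι] (s t : κ → ι) (f : ι → Option κ)
    (hn : none ∈ Set.range f) (hc : Connects s t {e | some e ∈ Set.range f}) :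
    ((bordered s t).submatrix id f).det ^ 2 = (Fintype.card ι : ℤ) ^ 2 := by
  classical
  obtain ⟨v₀⟩ := ‹Nonempty ι›
  set A := (bordered s t).submatrix id f
  set r : ι → ℤ := fun w => if w = v₀ then (Fintype.card ι : ℤ) - 1 else -1 with hr
  -- An explicit basis of that lattice: column v₀ is m e_{v₀}, every other column j is e_j - e_{v₀}.
  -- As a rank-one perturbation of the identity, D has determinant m.
  set D : Matrix ι ι ℤ := 1 + Matrix.replicateCol Unit (Pi.single v₀ (1 : ℤ)) * Matrix.replicateRow Unit r
    with hD
  have hdet : D.det = Fintype.card ι := by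
    rw [hD, Matrix.det_one_add_replicateCol_mul_replicateRow]
    simp [hr]
  have hDcol : ∀ j, (fun i => D i j) = if j = v₀ then (Fintype.card ι : ℤ) • Pi.single v₀ 1
      else Pi.single j 1 - Pi.single v₀ 1 := by
    intro j
    ext i
    by_cases hj : j = v₀
    · subst hj
      by_cases hi : i = j
      · subst hi; simp [hD, hr, Matrix.mul_apply]
      · simp [hD, hr, Matrix.mul_apply, hi]
    · by_cases hi : i = v₀
      · subst hi
        simp [hD, hr, Matrix.mul_apply, hj, Ne.symm hj]
      · simp [hD, hr, Matrix.mul_apply, hj, hi, Matrix.one_apply, Pi.single_apply]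
  have hAcol : ∀ j, (fun i => A i j) ∈ LinearMap.range A.mulVecLin := fun j =>
    ⟨Pi.single j 1, by ext i; simp [Matrix.col]⟩
  have hDmem : ∀ j, (fun i => D i j) ∈ LinearMap.range D.mulVecLin := fun j =>
    ⟨Pi.single j 1, by ext i; simp [Matrix.col]⟩
  have hone : (1 : ι → ℤ) = ∑ v, (Pi.single v (1 : ℤ) - Pi.single v₀ 1) +
      (Fintype.card ι : ℤ) • Pi.single v₀ 1 := by
    ext i
    simp [Finset.sum_apply, Finset.sum_sub_distrib, Pi.single_apply]
  have h1 : A.det ∣ D.det := by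
    apply Matrix.det_dvd_det_of_mem_range
    have hdiff : ∀ x y : ι, (Pi.single x (1 : ℤ) - Pi.single y 1 : ι → ℤ) ∈
        LinearMap.range A.mulVecLin := by
      intro x y
      induction hc x y with
      | rel x y h =>
        obtain ⟨e, ⟨j, hj⟩, rfl, rfl⟩ := h
        convert hAcol j using 1
        ext i
        simp [A, hj, bordered, incidence]
      | refl x => simp
      | symm x y _ ih => simpa using neg_mem ih
      | trans x y z _ _ ih1 ih2 => simpa using add_mem ih1 ih2
    have hone' : (1 : ι → ℤ) ∈ LinearMap.range A.mulVecLin := by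
      obtain ⟨j, hj⟩ := hn
      convert hAcol j using 1
      ext i
      simp [A, hj, bordered]
    intro j
    rw [hDcol]
    split_ifs
    · rw [← sub_eq_iff_eq_add'] at hone
      rw [← hone]
      exact sub_mem hone' (sum_mem fun v _ => hdiff _ _)
    · exact hdiff _ _
  have h2 : D.det ∣ A.det := by
    apply Matrix.det_dvd_det_of_mem_range
    have hdiff : ∀ x : ι, (Pi.single x (1 : ℤ) - Pi.single v₀ 1 : ι → ℤ) ∈
        LinearMap.range D.mulVecLin := by
      intro x
      by_cases hx : x = v₀
      · simp [hx]
      · have := hDmem x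
        rwa [hDcol, if_neg hx] at this
    intro j
    rcases hj : f j with _ | e
    · have : (fun i => A i j) = 1 := by ext i; simp [A, hj, bordered]
      rw [this, hone]
      refine add_mem (sum_mem fun v _ => hdiff _) ?_
      have := hDmem v₀
      rwa [hDcol, if_pos rfl] at this
    · have : (fun i => A i j) = (Pi.single (s e) (1 : ℤ) - Pi.single v₀ 1) -
          (Pi.single (t e) (1 : ℤ) - Pi.single v₀ 1) := by
        ext i; simp [A, hj, bordered, incidence]
      rw [this]
      exact sub_mem (hdiff _) (hdiff _)
  rw [← hdet, ← Int.natAbs_eq_iff_sq_eq]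
  exact Nat.dvd_antisymm (Int.natAbs_dvd_natAbs.2 h1) (Int.natAbs_dvd_natAbs.2 h2)

end

theorem card_injective_image_eq {α β : Type*} [Fintype α] [DecidableEq α] [Fintype β]
    [DecidableEq β] (S : Finset β) (hS : S.card = Fintype.card α) :
    (Finset.univ.filter fun f : α → β => Function.Injective f ∧ Finset.univ.image f = S).card =
      (Fintype.card α).factorial := by
  have e : α ≃ S := Fintype.equivOfCardEq (by simp [hS])
  rw [← Fintype.card_equiv e, ← Finset.card_univ]
  symm
  refine Finset.card_bij (fun g _ a => (g a : β)) ?_ ?_ ?_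
  · intro g _
    simp only [Finset.mem_filter, Finset.mem_univ, true_and]
    refine ⟨Subtype.val_injective.comp g.injective, ?_⟩
    ext b
    simp only [Finset.mem_image, Finset.mem_univ, true_and]
    exact ⟨fun ⟨a, h⟩ => h ▸ (g a).2, fun h => ⟨g.symm ⟨b, h⟩, by simp⟩⟩
  · intro g _ g' _ h
    ext a
    exact congrFun h a
  · intro f hf
    simp only [Finset.mem_filter, Finset.mem_univ, true_and] at hf
    have hmem : ∀ a, f a ∈ S := fun a => hf.2 ▸ Finset.mem_image_of_mem f (Finset.mem_univ a)
    have hinj : Function.Injective fun a => (⟨f a, hmem a⟩ : S) := fun a b h =>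
      hf.1 (congrArg Subtype.val h)
    refine ⟨Equiv.ofBijective _ ((Fintype.bijective_iff_injective_and_card _).2
      ⟨hinj, by simp [hS]⟩), Finset.mem_univ _, rfl⟩

/-- The matrix-tree theorem, in terms of connecting edge sets of minimal size. -/
theorem det_incidence_mul_transpose_add [Fintype ι] [DecidableEq ι] [Nonempty ι] [Fintype κ]
    [DecidableEq κ] (s t : κ → ι) :
    (incidence ℤ s t * (incidence ℤ s t).transpose + Matrix.of fun _ _ => 1).det =
      (Fintype.card ι : ℤ) ^ 2 *
        ({F : Finset κ | F.card + 1 = Fintype.card ι ∧ Connects s t F}.ncard : ℤ) := by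
  classical
  set 𝒯 : Finset (Finset κ) :=
    Finset.univ.filter fun F => F.card + 1 = Fintype.card ι ∧ Connects s t F with hT
  have hncard : {F : Finset κ | F.card + 1 = Fintype.card ι ∧ Connects s t F}.ncard = 𝒯.card := by
    rw [← Set.ncard_coe_finset]
    simp [hT]
  rw [hncard, ← bordered_mul_transpose]
  have hfac : ((Fintype.card ι).factorial : ℤ) ≠ 0 := by positivity
  refine mul_left_cancel₀ hfac ?_
  rw [Matrix.factorial_mul_det_mul]
  have hsq : ∀ f : ι → Option κ, ((bordered s t).submatrix id f).det *
      ((bordered s t).transpose.submatrix f id).det =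
      ((bordered s t).submatrix id f).det ^ 2 := by
    intro f
    rw [← Matrix.transpose_submatrix, Matrix.det_transpose, sq]
  simp_rw [hsq]
  have himage : ∀ (f : ι → Option κ) (F : Finset κ), Finset.univ.image f = F.insertNone →
      none ∈ Set.range f ∧ {e | some e ∈ Set.range f} = (F : Set κ) := by
    intro f F h
    have h' : ∀ o, o ∈ Set.range f ↔ o ∈ F.insertNone := by
      intro o
      rw [← h]
      simp
    refine ⟨(h' _).2 (by simp), ?_⟩
    ext e
    rw [Set.mem_ofPred_eq, h']
    simp
  -- The maps with nonzero minor: each enumerates the column of ones together with a minimal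
  -- connecting set F. Every F has m! enumerations, each contributing m², so the factorial cancels.
  set 𝒢 : Finset (ι → Option κ) := 𝒯.biUnion fun F => Finset.univ.filter fun f =>
    Function.Injective f ∧ Finset.univ.image f = F.insertNone with hG
  have hcard : 𝒢.card = 𝒯.card * (Fintype.card ι).factorial := by
    rw [hG, Finset.card_biUnion, Finset.sum_const_nat]
    · intro F hF
      refine card_injective_image_eq _ ?_
      rw [Finset.card_insertNone]
      exact (Finset.mem_filter.1 hF).2.1
    · intro F _ F' _ hne
      rw [Function.onFun, Finset.disjoint_left]
      intro f hf hf'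
      simp only [Finset.mem_filter, Finset.mem_univ, true_and] at hf hf'
      exact hne (Finset.insertNone.injective (hf.2.symm.trans hf'.2))
  have hsub : ∑ f : ι → Option κ, ((bordered s t).submatrix id f).det ^ 2 =
      ∑ f ∈ 𝒢, ((bordered s t).submatrix id f).det ^ 2 := by
    symm
    apply Finset.sum_subset (Finset.subset_univ _)
    intro f _ hf
    by_contra hne
    have hne' : ((bordered s t).submatrix id f).det ≠ 0 := fun h => hne (by rw [h]; rfl)
    apply hf
    have hinj := injective_of_det_ne_zero s t f hne'
    have him : Finset.univ.image f = ((Finset.univ.image f).eraseNone).insertNone := by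
      rw [Finset.insertNone_eraseNone, Finset.insert_eq_of_mem]
      simpa using none_mem_range_of_det_ne_zero s t f hne'
    rw [hG, Finset.mem_biUnion]
    refine ⟨(Finset.univ.image f).eraseNone, ?_, ?_⟩
    · rw [hT, Finset.mem_filter]
      refine ⟨Finset.mem_univ _, ?_, ?_⟩
      · rw [← Finset.card_insertNone, ← him, Finset.card_image_of_injective _ hinj,
          Finset.card_univ]
      · rw [← (himage f _ him).2]
        exact connects_of_det_ne_zero s t f hne'
    · exact Finset.mem_filter.2 ⟨Finset.mem_univ _, hinj, him⟩
  rw [hsub, Finset.sum_congr rfl (g := fun _ => (Fintype.card ι : ℤ) ^ 2), Finset.sum_const, hcard,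
    nsmul_eq_mul]
  · push_cast; ring
  · intro f hf
    rw [hG, Finset.mem_biUnion] at hf
    obtain ⟨F, hF, hf⟩ := hf
    simp only [Finset.mem_filter, Finset.mem_univ, true_and, hT] at hF hf
    obtain ⟨h1, h2⟩ := himage f F hf.2
    exact det_sq_of_connects s t f h1 (h2 ▸ hF.2)

end Foliation

/-! ### Spanning trees of multigraphs as minimal connecting edge sets -/

namespace Foliation

section

variable {V E ι κ : Type*}

theorem connected_iff_connects [Nonempty ι] (T : Graph V E) (φ : ι ≃ V(T)) (ψ : κ → E)
    (s t : κ → ι) (F : Set κ) (hF : E(T) = ψ '' F)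
    (h : ∀ k ∈ F, T.IsLink (ψ k) (φ (s k)) (φ (t k))) :
    T.toSimpleGraph.Connected ↔ Connects s t F := by
  have hne : Nonempty V(T) := φ.nonempty_congr.1 ‹_›
  rw [SimpleGraph.connected_iff]
  constructor
  · rintro ⟨hp, -⟩
    have key : ∀ u v : V(T), Relation.ReflTransGen T.toSimpleGraph.Adj u v →
        Relation.EqvGen (fun a b => ∃ e ∈ F, s e = a ∧ t e = b) (φ.symm u) (φ.symm v) := by
      intro u v huv
      induction huv with
      | refl => exact Relation.EqvGen.refl _
      | tail _ hadj ih =>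
        refine ih.trans _ _ _ ?_
        obtain ⟨-, e, he⟩ := hadj
        obtain ⟨k, hk, rfl⟩ := hF ▸ he.edge_mem
        rcases (h k hk).eq_and_eq_or_eq_and_eq he with ⟨h1, h2⟩ | ⟨h1, h2⟩
        · rw [← Subtype.ext h1, ← Subtype.ext h2]
          exact Relation.EqvGen.rel _ _ ⟨k, hk, by simp⟩
        · rw [← Subtype.ext h1, ← Subtype.ext h2]
          exact (Relation.EqvGen.rel _ _ ⟨k, hk, by simp⟩).symm
    intro x y
    simpa using key (φ x) (φ y) ((SimpleGraph.reachable_iff_reflTransGen _ _).1 (hp _ _))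
  · intro hc
    refine ⟨fun u v => ?_, hne⟩
    have key : ∀ x y, Relation.EqvGen (fun a b => ∃ e ∈ F, s e = a ∧ t e = b) x y →
        T.toSimpleGraph.Reachable (φ x) (φ y) := by
      intro x y hxy
      induction hxy with
      | rel x y h' =>
        obtain ⟨k, hk, rfl, rfl⟩ := h'
        by_cases heq : φ (s k) = φ (t k)
        · rw [heq]
        · exact SimpleGraph.Adj.reachable ⟨heq, _, h k hk⟩
      | refl x => exact SimpleGraph.Reachable.refl _
      | symm x y _ ih => exact ih.symm
      | trans x y z _ _ ih1 ih2 => exact ih1.trans ih2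
    simpa using key _ _ (hc (φ.symm u) (φ.symm v))

/-- A connected simple graph on m vertices has at least m - 1 edges. So when m - 1 multigraph edges
connect everything, no edge can be lost in passing to the simple graph, which excludes loops and
parallel edges. -/
theorem simple_and_isTree_iff [Fintype ι] [Nonempty ι] (T : Graph V E) (φ : ι ≃ V(T)) (ψ : κ → E)
    (hψ : Function.Injective ψ) (s t : κ → ι) (F : Finset κ) (hF : E(T) = ψ '' F)
    (h : ∀ k ∈ F, T.IsLink (ψ k) (φ (s k)) (φ (t k))) :
    T.Simple ∧ T.toSimpleGraph.IsTree ↔ F.card + 1 = Fintype.card ι ∧ Connects s t F := by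
  classical
  have : Finite V(T) := Finite.of_equiv _ φ
  rw [SimpleGraph.isTree_iff_connected_and_card, connected_iff_connects T φ ψ s t F hF h,
    ← Nat.card_congr φ, Nat.card_eq_fintype_card (α := ι), Nat.card_coe_set_eq]
  set ends : κ → Sym2 V(T) := fun k => s(φ (s k), φ (t k)) with hends
  have hlink : ∀ k ∈ F, ∀ x y : V(T), T.IsLink (ψ k) x y ↔ ends k = s(x, y) := by
    intro k hk x y
    rw [(h k hk).isLink_iff, hends, Sym2.eq_iff]
    simp only [Subtype.ext_iff]
  have hsub : T.toSimpleGraph.edgeSet ⊆ (F.image ends : Set (Sym2 V(T))) := by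
    intro z
    induction z with
    | h u v =>
      rintro ⟨-, e, he⟩
      obtain ⟨k, hk, rfl⟩ := hF ▸ he.edge_mem
      rw [Finset.coe_image]
      exact ⟨k, hk, (hlink k hk u v).1 he⟩
  constructor
  · rintro ⟨hs, hc, hcard⟩
    refine ⟨?_, hc⟩
    rw [← hcard]
    congr 1
    have : T.toSimpleGraph.edgeSet = (F.image ends : Set (Sym2 V(T))) := by
      refine hsub.antisymm ?_
      rw [Finset.coe_image]
      rintro _ ⟨k, hk, rfl⟩
      exact ⟨fun h' => (h k hk).ne (congrArg Subtype.val h'), _, h k hk⟩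
    rw [this, Set.ncard_coe_finset, Finset.card_image_of_injOn]
    intro k hk k' hk' heq
    exact hψ (Graph.IsLink.eq ((hlink k hk _ _).2 rfl) ((hlink k' hk' _ _).2 heq.symm))
  · rintro ⟨hcard, hc⟩
    have hle := ((connected_iff_connects T φ ψ s t F hF h).2
      hc).card_vert_le_card_edgeSet_add_one
    rw [← Nat.card_congr φ, Nat.card_eq_fintype_card (α := ι), Nat.card_coe_set_eq] at hle
    have h1 : T.toSimpleGraph.edgeSet.ncard ≤ (F.image ends).card := by
      rw [← Set.ncard_coe_finset]
      exact Set.ncard_le_ncard hsub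
    have h2 : (F.image ends).card ≤ F.card := Finset.card_image_le
    have hinj : Set.InjOn ends F := Finset.card_image_iff.1 (by omega)
    have heq : T.toSimpleGraph.edgeSet = (F.image ends : Set (Sym2 V(T))) := by
      refine Set.eq_of_subset_of_ncard_le hsub ?_
      rw [Set.ncard_coe_finset]
      omega
    refine ⟨{ not_isLoopAt := ?_, eq_of_isLink := ?_ }, hc, by omega⟩
    · intro e x he
      have hx : x ∈ V(T) := Graph.IsLink.left_mem he
      obtain ⟨k, hk, rfl⟩ := hF ▸ Graph.IsLink.edge_mem he
      have : ends k ∈ T.toSimpleGraph.edgeSet := by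
        rw [heq, Finset.coe_image]
        exact ⟨k, hk, rfl⟩
      rw [(hlink k hk ⟨x, hx⟩ ⟨x, hx⟩).1 he] at this
      exact T.toSimpleGraph.loopless.irrefl _ this
    · intro e e' x y he he'
      obtain ⟨k, hk, rfl⟩ := hF ▸ he.edge_mem
      obtain ⟨k', hk', rfl⟩ := hF ▸ he'.edge_mem
      have h3 := (hlink k hk ⟨x, he.left_mem⟩ ⟨y, he.right_mem⟩).1 he
      have h4 := (hlink k' hk' ⟨x, he.left_mem⟩ ⟨y, he.right_mem⟩).1 he'
      rw [hinj hk hk' (h3.trans h4.symm)]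

theorem complexity_eq_ncard [Fintype ι] [Nonempty ι] [Fintype κ] (G : Graph V E)
    (φ : ι ≃ V(G)) (ψ : κ ≃ E(G)) (s t : κ → ι)
    (h : ∀ k, G.IsLink (ψ k) (φ (s k)) (φ (t k))) :
    complexity G = {F : Finset κ | F.card + 1 = Fintype.card ι ∧ Connects s t F}.ncard := by
  classical
  have hψ : Function.Injective fun k => (ψ k : E) := Subtype.val_injective.comp ψ.injective
  symm
  refine Set.ncard_congr (fun F _ => G.restrict ((fun k => (ψ k : E)) '' F)) ?_ ?_ ?_
  · intro F hF
    refine ⟨⟨Graph.restrict_le, rfl⟩, ?_⟩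
    refine (simple_and_isTree_iff (G.restrict ((fun k => (ψ k : E)) '' F)) φ
      (fun k => (ψ k : E)) hψ s t F ?_ fun k hk => ⟨⟨k, hk, rfl⟩, h k⟩).2 hF
    rw [Graph.edgeSet_restrict, Set.inter_eq_right]
    rintro _ ⟨k, -, rfl⟩
    exact (ψ k).2
  · intro F F' _ _ hFF'
    have h1 := congrArg Graph.edgeSet hFF'
    simp only [Graph.edgeSet_restrict] at h1
    rw [Set.inter_eq_right.2, Set.inter_eq_right.2] at h1
    · exact Finset.coe_injective (hψ.image_injective h1)
    all_goals
      rintro _ ⟨k, -, rfl⟩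
      exact (ψ k).2
  · rintro T ⟨hTG, hT⟩
    have hE : E(T) = (fun k => (ψ k : E)) ''
        ((Finset.univ.filter fun k => (ψ k : E) ∈ E(T) : Finset κ) : Set κ) := by
      ext e
      simp only [Finset.coe_filter, Finset.mem_univ, true_and, Set.mem_image, Set.mem_ofPred_eq]
      constructor
      · intro he
        exact ⟨ψ.symm ⟨e, hTG.le.edgeSet_mono he⟩, by simpa using he, by simp⟩
      · rintro ⟨k, hk, rfl⟩
        exact hk
    refine ⟨Finset.univ.filter fun k => (ψ k : E) ∈ E(T), ?_, ?_⟩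
    · refine (simple_and_isTree_iff T (φ.trans (Equiv.setCongr hTG.vertexSet_eq.symm))
        (fun k => (ψ k : E)) hψ s t _ hE ?_).1 hT
      intro k hk
      exact (hTG.le.isLink_iff (Finset.mem_filter.1 hk).2).2 (h k)
    · refine Graph.Compatible.ext hTG.vertexSet_eq.symm ?_
        (Graph.Compatible.of_le_le Graph.restrict_le hTG.le)
      rw [Graph.edgeSet_restrict, ← hE]
      exact Set.inter_eq_right.2 hTG.le.edgeSet_mono

/-- The matrix-tree theorem for multigraphs. -/
theorem det_incidence_eq_complexity [Fintype ι] [DecidableEq ι] [Nonempty ι] [Fintype κ]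
    (G : Graph V E) (φ : ι ≃ V(G)) (ψ : κ ≃ E(G)) (s t : κ → ι)
    (h : ∀ k, G.IsLink (ψ k) (φ (s k)) (φ (t k))) :
    (incidence ℤ s t * (incidence ℤ s t).transpose + Matrix.of fun _ _ => 1).det =
      (Fintype.card ι : ℤ) ^ 2 * (complexity G : ℤ) := by
  classical
  rw [det_incidence_mul_transpose_add, complexity_eq_ncard G φ ψ s t h]

end

end Foliation

/-! ### Chebyshev polynomials and products over the nodes 2cos(2πj/n) -/

namespace Foliation

open Polynomial

section Chebyshev

/-- The source of all squares: away from ±2, C_n - 2 is the square of an integral polynomial. Both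
parities are proved together since the recurrence for C alternates between them; the quadratic
relation between consecutive S closes the induction. -/
theorem chebyshevC_sub_two (R : Type*) [CommRing R] (k : ℕ) :
    Chebyshev.C R (2 * k : ℤ) - 2 = (X ^ 2 - 4) * Chebyshev.S R (k - 1 : ℤ) ^ 2 ∧
    Chebyshev.C R (2 * k + 1 : ℤ) - 2 =
      (X - 2) * (Chebyshev.S R (k : ℤ) + Chebyshev.S R (k - 1 : ℤ)) ^ 2 := by
  induction k with
  | zero => simp
  | succ k ih =>
    obtain ⟨h1, h2⟩ := ih
    have hS := Chebyshev.S_sq_add_S_sq R (k - 1 : ℤ)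
    rw [sub_add_cancel] at hS
    have e1 : Chebyshev.C R (2 * (k + 1 : ℕ) : ℤ) =
        X * Chebyshev.C R (2 * k + 1 : ℤ) - Chebyshev.C R (2 * k : ℤ) := by
      rw [← Chebyshev.C_add_two]
      congr 1
    have e2 : Chebyshev.C R (2 * (k + 1 : ℕ) + 1 : ℤ) =
        X * Chebyshev.C R (2 * (k + 1 : ℕ) : ℤ) - Chebyshev.C R (2 * k + 1 : ℤ) := by
      have := Chebyshev.C_add_two R (2 * k + 1)
      rw [show (2 * (k + 1 : ℕ) + 1 : ℤ) = 2 * k + 1 + 2 by push_cast; ring, this]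
      congr 3
    have e3 : Chebyshev.S R ((k + 1 : ℕ) : ℤ) =
        X * Chebyshev.S R (k : ℤ) - Chebyshev.S R (k - 1 : ℤ) := by
      rw [← Chebyshev.S_add_one]
      congr 1
    have e4 : (((k + 1 : ℕ) : ℤ) - 1) = k := by push_cast; ring
    rw [e4]
    have h3 : Chebyshev.C R (2 * (k + 1 : ℕ) : ℤ) - 2 =
        (X ^ 2 - 4) * Chebyshev.S R (k : ℤ) ^ 2 := by
      rw [e1]
      linear_combination X * h2 - h1 - 2 * (X - 2) * hS
    refine ⟨h3, ?_⟩
    rw [e2, e3]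
    linear_combination X * h3 - h2 - 2 * (X - 2) * hS

theorem chebyshevC_eval_add_inv {z : ℂ} (hz : z ≠ 0) (n : ℕ) :
    (Chebyshev.C ℂ n).eval (z + z⁻¹) = z ^ n + z⁻¹ ^ n := by
  induction n using Nat.twoStepInduction with
  | zero => norm_num
  | one => simp
  | more n h1 h2 =>
    have := Chebyshev.C_add_two ℂ n
    push_cast at h2 ⊢
    rw [this, eval_sub, eval_mul, eval_X, h1, h2]
    linear_combination (z ^ n + z⁻¹ ^ n) * mul_inv_cancel₀ hz

theorem exists_add_inv_eq (w : ℂ) : ∃ z : ℂ, z ≠ 0 ∧ z + z⁻¹ = w := by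
  obtain ⟨θ, hθ⟩ := Complex.cos_surjective (w / 2)
  refine ⟨Complex.exp (θ * Complex.I), Complex.exp_ne_zero _, ?_⟩
  rw [← Complex.exp_neg, ← neg_mul, ← Complex.two_cos, hθ]
  ring

theorem prod_sub_stdAddChar (n : ℕ) [NeZero n] (z : ℂ) :
    ∏ j : ZMod n, (z - ZMod.stdAddChar j) = z ^ n - 1 := by
  classical
  have hpow : ∀ j : ZMod n, (ZMod.stdAddChar j : ℂ) ^ n = 1 := by
    intro j
    rw [← AddChar.map_nsmul_eq_pow]
    simp
  have hprim : IsPrimitiveRoot (ZMod.stdAddChar (1 : ZMod n) : ℂ) n := by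
    refine ⟨hpow 1, fun l hl => ?_⟩
    rw [← AddChar.map_nsmul_eq_pow, ← AddChar.map_zero_eq_one (ZMod.stdAddChar (N := n))] at hl
    have := ZMod.injective_stdAddChar hl
    rwa [nsmul_one, ZMod.natCast_eq_zero_iff] at this
  have hn : 0 < n := Nat.pos_of_ne_zero (NeZero.ne n)
  have himage : Finset.univ.image (fun j : ZMod n => (ZMod.stdAddChar j : ℂ)) =
      nthRootsFinset n (1 : ℂ) := by
    apply Finset.eq_of_subset_of_card_le
    · intro x hx
      obtain ⟨j, -, rfl⟩ := Finset.mem_image.1 hx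
      exact (mem_nthRootsFinset hn _).2 (hpow j)
    · rw [Finset.card_image_of_injective _ ZMod.injective_stdAddChar, hprim.card_nthRootsFinset,
        Finset.card_univ, ZMod.card]
  have := hprim.pow_sub_pow_eq_prod_sub_mul z 1 hn
  rw [one_pow] at this
  rw [this, ← himage, Finset.prod_image fun a _ b _ h => ZMod.injective_stdAddChar h]
  simp

/-- `2 cos (2 π j / n)`. -/
noncomputable def cosNode {n : ℕ} [NeZero n] (j : ZMod n) : ℂ :=
  ZMod.stdAddChar j + (ZMod.stdAddChar j : ℂ)⁻¹

theorem cosNode_zero {n : ℕ} [NeZero n] : cosNode (0 : ZMod n) = 2 := by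
  simp [cosNode]; norm_num

theorem stdAddChar_ne_zero {n : ℕ} [NeZero n] (j : ZMod n) : (ZMod.stdAddChar j : ℂ) ≠ 0 := by
  rw [ZMod.stdAddChar_apply]
  exact Circle.coe_ne_zero _

/-- At w = z + 1/z the factor for ζ is (z - ζ)(z - 1/ζ)/z, so the product is (z^n - 1)²/z^n = z^n +
z^{-n} - 2. -/
theorem prod_X_sub_cosNode (n : ℕ) [NeZero n] :
    ∏ j : ZMod n, (X - C (cosNode j)) = Chebyshev.C ℂ n - 2 := by
  apply Polynomial.funext
  intro w
  obtain ⟨z, hz, rfl⟩ := exists_add_inv_eq w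
  have h : ∀ j : ZMod n, z + z⁻¹ - cosNode j =
      (z - ZMod.stdAddChar j) * (z - ZMod.stdAddChar (-j)) * z⁻¹ := by
    intro j
    have := stdAddChar_ne_zero j
    rw [cosNode, AddChar.map_neg_eq_inv]
    field_simp
    ring
  have h1 : ∏ j : ZMod n, (z - ZMod.stdAddChar (-j)) = z ^ n - 1 := by
    rw [← prod_sub_stdAddChar]
    exact Fintype.prod_equiv (Equiv.neg _) _ _ fun j => rfl
  rw [eval_prod]
  simp only [eval_sub, eval_X, eval_C, h, Finset.prod_mul_distrib, h1, prod_sub_stdAddChar,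
    chebyshevC_eval_add_inv hz]
  rw [Finset.prod_const, Finset.card_univ, ZMod.card, eval_ofNat]
  have : z ^ n * z⁻¹ ^ n = 1 := by rw [← mul_pow, mul_inv_cancel₀ hz, one_pow]
  linear_combination (z ^ n - 2) * this

theorem prod_erase_X_sub_cosNode (n : ℕ) [NeZero n] :
    (X - 2) * ∏ j ∈ Finset.univ.erase (0 : ZMod n), (X - C (cosNode j)) =
      Chebyshev.C ℂ n - 2 := by
  rw [← prod_X_sub_cosNode, ← Finset.mul_prod_erase _ _ (Finset.mem_univ (0 : ZMod n)),
    cosNode_zero]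
  rfl

theorem X_sub_two_ne_zero : (X - 2 : ℂ[X]) ≠ 0 := X_sub_C_ne_zero 2

theorem prod_erase_odd {n : ℕ} [NeZero n] {k : ℕ} (hn : n = 2 * k + 1) :
    ∏ j ∈ Finset.univ.erase (0 : ZMod n), (X - C (cosNode j)) =
      ((Chebyshev.S ℤ (k : ℤ) + Chebyshev.S ℤ (k - 1 : ℤ)).map (Int.castRingHom ℂ)) ^ 2 := by
  refine mul_left_cancel₀ X_sub_two_ne_zero ?_
  rw [prod_erase_X_sub_cosNode, Polynomial.map_add, Chebyshev.map_S, Chebyshev.map_S,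
    ← (chebyshevC_sub_two ℂ k).2, hn]
  push_cast
  rfl

theorem prod_erase_even {n : ℕ} [NeZero n] {k : ℕ} (hn : n = 2 * (k + 1)) :
    ∏ j ∈ Finset.univ.erase (0 : ZMod n), (X - C (cosNode j)) =
      (X + 2) * ((Chebyshev.S ℤ (k : ℤ)).map (Int.castRingHom ℂ)) ^ 2 := by
  refine mul_left_cancel₀ X_sub_two_ne_zero ?_
  have := (chebyshevC_sub_two ℂ (k + 1)).1
  rw [Nat.cast_add_one, add_sub_cancel_right] at this
  rw [prod_erase_X_sub_cosNode, Chebyshev.map_S, hn]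
  push_cast
  rw [this]
  ring

/-- The product differs from the resultant by a power of the leading coefficient of F. That
coefficient squares to 1, so the difference disappears on squaring. This is where integrality
enters. -/
theorem prod_eval_roots_sq_eq_resultant_sq (F h : ℤ[X])
    (hF : ((F.map (Int.castRingHom ℂ)) ^ 2).Monic) :
    ((F.map (Int.castRingHom ℂ)).roots.map (h.map (Int.castRingHom ℂ)).eval).prod ^ 2 =
      ((resultant F h : ℤ) : ℂ) ^ 2 := by
  have hinj : Function.Injective (Int.castRingHom ℂ) := Int.cast_injective
  have h1 := resultant_eq_prod_eval (F.map (Int.castRingHom ℂ)) (h.map (Int.castRingHom ℂ))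
    (h.map (Int.castRingHom ℂ)).natDegree le_rfl (IsAlgClosed.splits _)
  rw [natDegree_map_eq_of_injective hinj, natDegree_map_eq_of_injective hinj,
    resultant_map_map] at h1
  have h2 : (F.map (Int.castRingHom ℂ)).leadingCoeff ^ 2 = 1 := by
    rw [← leadingCoeff_pow]; exact hF
  have h3 : ((resultant F h : ℤ) : ℂ) = Int.castRingHom ℂ (resultant F h) := rfl
  rw [h3, h1, mul_pow, ← pow_mul, mul_comm h.natDegree, pow_mul, h2, one_pow, one_mul]

theorem prod_eval_eq_prod_roots {α : Type*} (s : Finset α) (x : α → ℂ) (h : ℂ[X]) :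
    ∏ j ∈ s, h.eval (x j) = ((∏ j ∈ s, (X - C (x j))).roots.map h.eval).prod := by
  have : ∏ j ∈ s, (X - C (x j)) = ((s.val.map x).map fun a => X - C a).prod := by
    rw [Multiset.map_map]; rfl
  rw [this, roots_multiset_prod_X_sub_C, Multiset.map_map]
  rfl

theorem prod_sub_two (n : ℕ) [NeZero n] :
    ∏ j ∈ Finset.univ.erase (0 : ZMod n), (cosNode j - 2) = (-1) ^ (n - 1) *
      (∏ j ∈ Finset.univ.erase (0 : ZMod n), (X - C (cosNode j))).eval 2 := by
  have : n - 1 = (Finset.univ.erase (0 : ZMod n)).card := by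
    rw [Finset.card_erase_of_mem (Finset.mem_univ _), Finset.card_univ, ZMod.card]
  rw [this, ← Finset.prod_const, eval_prod, ← Finset.prod_mul_distrib]
  refine Finset.prod_congr rfl fun j _ => ?_
  simp

theorem prod_aeval_cosNode_odd {n : ℕ} [NeZero n] (hn : Odd n) (g : ℤ[X]) :
    ∃ N : ℤ, ∏ j ∈ Finset.univ.erase (0 : ZMod n), aeval (cosNode j) ((X - 2) * g) =
      (n : ℂ) ^ 2 * (N : ℂ) ^ 2 := by
  obtain ⟨k, hk⟩ := hn
  have hprod := prod_erase_odd hk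
  refine ⟨resultant (Chebyshev.S ℤ (k : ℤ) + Chebyshev.S ℤ (k - 1 : ℤ)) g, ?_⟩
  rw [← prod_eval_roots_sq_eq_resultant_sq]
  · simp only [map_mul, map_sub, aeval_X, map_ofNat, Finset.prod_mul_distrib]
    congr 1
    -- S_k(2) + S_{k-1}(2) = (k + 1) + k = n.
    · rw [prod_sub_two, hprod, hk]
      simp only [Polynomial.map_add, Chebyshev.map_S, eval_pow, eval_add, Chebyshev.S_eval_two]
      simp
      ring
    · simp only [aeval_def, eval₂_eq_eval_map, algebraMap_int_eq]
      rw [prod_eval_eq_prod_roots, hprod, roots_pow, Multiset.map_nsmul, Multiset.prod_nsmul]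
  · rw [← hprod]
    exact monic_prod_of_monic _ _ fun j _ => monic_X_sub_C _

/-- The node -2 (at j = n/2) is unpaired and contributes g(-2); the minus sign is (-1)^{n-1} from ∏
(x_j - 2). -/
theorem prod_aeval_cosNode_even {n : ℕ} [NeZero n] (hn : Even n) (g : ℤ[X]) :
    ∃ N : ℤ, ∏ j ∈ Finset.univ.erase (0 : ZMod n), aeval (cosNode j) ((X - 2) * g) =
      -(n : ℂ) ^ 2 * (g.eval (-2) : ℤ) * (N : ℂ) ^ 2 := by
  obtain ⟨k, hk⟩ : ∃ k, n = 2 * (k + 1) := by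
    obtain ⟨m, hm⟩ := hn
    have := NeZero.ne n
    exact ⟨m - 1, by omega⟩
  have hprod := prod_erase_even hk
  have hmonic : (∏ j ∈ Finset.univ.erase (0 : ZMod n), (X - C (cosNode j))).Monic :=
    monic_prod_of_monic _ _ fun j _ => monic_X_sub_C _
  have hX2 : (X + 2 : ℂ[X]).Monic := monic_X_add_C 2
  have hX2roots : (X + 2 : ℂ[X]).roots = {-2} := roots_X_add_C 2
  refine ⟨resultant (Chebyshev.S ℤ (k : ℤ)) g, ?_⟩
  rw [← prod_eval_roots_sq_eq_resultant_sq]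
  · simp only [map_mul, map_sub, aeval_X, map_ofNat, Finset.prod_mul_distrib]
    rw [mul_assoc]
    congr 1
    · rw [prod_sub_two, hprod, hk]
      have : 2 * (k + 1) - 1 = 2 * k + 1 := by omega
      simp only [Chebyshev.map_S, eval_pow, eval_add, eval_mul, Chebyshev.S_eval_two, this]
      simp [pow_succ, pow_mul]
      ring
    · simp only [aeval_def, eval₂_eq_eval_map, algebraMap_int_eq]
      rw [prod_eval_eq_prod_roots, hprod, roots_mul (hprod ▸ hmonic.ne_zero), hX2roots, roots_pow,
        Multiset.map_add, Multiset.prod_add, Multiset.map_nsmul, Multiset.prod_nsmul]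
      congr 1
      have := Polynomial.eval_map_apply (f := Int.castRingHom ℂ) (p := g) (-2)
      simpa using this
  · exact hX2.of_mul_monic_left (hprod ▸ hmonic)

end Chebyshev

end Foliation

/-! ### Fourier transform of the foliation Laplacian -/

namespace Foliation

section Incidence

variable {ι κ R : Type*} [DecidableEq ι] [CommRing R]

theorem transpose_incidence_mul [Fintype ι] {γ : Type*} (s t : κ → ι) (K : Matrix ι γ R) (e : κ)
    (c : γ) : ((incidence R s t).transpose * K) e c = K (s e) c - K (t e) c := by
  simp [Matrix.mul_apply, incidence, sub_mul, Finset.sum_sub_distrib, Pi.single_apply]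

theorem incidence_mul_apply [Fintype κ] {γ : Type*} (s t : κ → ι) (Y : Matrix κ γ R) (v : ι)
    (c : γ) : (incidence R s t * Y) v c =
      ∑ e, (Pi.single (M := fun _ => R) (s e) 1 v - Pi.single (M := fun _ => R) (t e) 1 v) *
        Y e c := rfl

theorem map_laplacian [Fintype κ] {R' : Type*} [CommRing R'] (f : R →+* R') (s t : κ → ι) :
    (incidence R s t * (incidence R s t).transpose).map f =
      incidence R' s t * (incidence R' s t).transpose := by
  ext u v
  simp [Matrix.mul_apply, incidence, Pi.single_apply, apply_ite f]

theorem map_det_laplacian_add_one [Fintype ι] [Fintype κ] {R' : Type*} [CommRing R'] (f : R →+* R')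
    (s t : κ → ι) :
    f (incidence R s t * (incidence R s t).transpose + Matrix.of fun _ _ => 1).det =
      (incidence R' s t * (incidence R' s t).transpose + Matrix.of fun _ _ => 1).det := by
  rw [RingHom.map_det, RingHom.mapMatrix_apply, Matrix.map_add _ (map_add f), map_laplacian]
  congr 2
  ext
  simp

end Incidence

section DFT

variable {ι κ : Type*} [Fintype ι] [DecidableEq ι] [Fintype κ] {n : ℕ} [NeZero n]

/-- The sources of the oriented edges of a circulant foliation. -/
def foliationSource (n : ℕ) (s : κ → ι) (S : ι → Finset ℕ) :
    ZMod n × (κ ⊕ Σ v : ι, S v) → ZMod n × ι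
  | (k, Sum.inl e) => (k, s e)
  | (k, Sum.inr ⟨v, _⟩) => (k, v)

/-- The targets of the oriented edges of a circulant foliation. -/
def foliationTarget (n : ℕ) (t : κ → ι) (S : ι → Finset ℕ) :
    ZMod n × (κ ⊕ Σ v : ι, S v) → ZMod n × ι
  | (k, Sum.inl e) => (k, t e)
  | (k, Sum.inr ⟨v, j⟩) => (k + ((j : ℕ) : ZMod n), v)

/-- The discrete Fourier transform along the fibers. -/
noncomputable def fiberDFT (n : ℕ) [NeZero n] (ι : Type*) [DecidableEq ι] :
    Matrix (ZMod n × ι) (ZMod n × ι) ℂ :=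
  Matrix.kroneckerMap (· * ·) (Matrix.of fun k j : ZMod n => (ZMod.stdAddChar (k * j) : ℂ)) 1

theorem fiberDFT_apply {ι : Type*} [DecidableEq ι] (k j : ZMod n) (u w : ι) : fiberDFT n ι (k, u) (j, w) =
    ZMod.stdAddChar (k * j) * (1 : Matrix ι ι ℂ) u w := rfl

theorem sum_stdAddChar_mul (j : ZMod n) :
    ∑ k : ZMod n, (ZMod.stdAddChar (k * j) : ℂ) = if j = 0 then (n : ℂ) else 0 := by
  have := AddChar.sum_mulShift j (ZMod.isPrimitive_stdAddChar n)
  rw [ZMod.card] at this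
  exact_mod_cast this

theorem det_fiberDFT_ne_zero : (fiberDFT n ι).det ≠ 0 := by
  rw [fiberDFT, Matrix.det_kronecker, Matrix.det_one, one_pow, mul_one]
  refine pow_ne_zero _ fun h => ?_
  have hmul : (Matrix.of fun k j : ZMod n => (ZMod.stdAddChar (k * j) : ℂ)) *
      (Matrix.of fun k j : ZMod n => (ZMod.stdAddChar (-(k * j)) : ℂ)) = (n : ℂ) • 1 := by
    ext a b
    have := sum_stdAddChar_mul (a - b)
    simp only [Matrix.mul_apply, Matrix.of_apply, ← AddChar.map_add_eq_mul, Matrix.smul_apply,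
      Matrix.one_apply, smul_eq_mul, mul_ite, mul_one, mul_zero]
    simp only [sub_eq_zero] at this
    rw [← this]
    refine Finset.sum_congr rfl fun k _ => ?_
    congr 1
    ring
  have := congrArg Matrix.det hmul
  rw [Matrix.det_mul, h, zero_mul, Matrix.det_smul, Matrix.det_one, mul_one] at this
  exact pow_ne_zero _ (Nat.cast_ne_zero.2 (NeZero.ne n)) this.symm

/-- The diagonal blocks of the Fourier transform of the Laplacian of a circulant foliation. -/
noncomputable def fiberBlock (s t : κ → ι) (S : ι → Finset ℕ) (j : ZMod n) : Matrix ι ι ℂ :=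
  incidence ℂ s t * (incidence ℂ s t).transpose +
    Matrix.diagonal fun v => ∑ a ∈ S v, (2 - (ZMod.stdAddChar ((a : ZMod n) * j) : ℂ) -
      (ZMod.stdAddChar ((a : ZMod n) * j) : ℂ)⁻¹)

/-- Characters of ℤ/n are eigenvectors of shifts: a jump a at v acts on the j-th character by the
scalar 2 - ζ - 1/ζ with ζ its value at a, while edges of H act inside each fiber index. -/
theorem foliation_laplacian_mul_fiberDFT (s t : κ → ι) (S : ι → Finset ℕ) (k j : ZMod n)
    (u w : ι) :
    (incidence ℂ (foliationSource n s S) (foliationTarget n t S) *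
      (incidence ℂ (foliationSource n s S) (foliationTarget n t S)).transpose *
        fiberDFT n ι) (k, u) (j, w) =
      ZMod.stdAddChar (k * j) * fiberBlock s t S j u w := by
  rw [Matrix.mul_assoc, incidence_mul_apply]
  simp only [transpose_incidence_mul]
  rw [Fintype.sum_prod_type]
  simp only [Fintype.sum_sum_type, Fintype.sum_sigma, foliationSource, foliationTarget,
    Finset.sum_add_distrib, fiberDFT_apply]
  rw [fiberBlock, Matrix.add_apply, mul_add]
  congr 1
  · rw [incidence_mul_apply, Finset.sum_comm, Finset.mul_sum]
    refine Finset.sum_congr rfl fun e _ => ?_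
    have h1 : ∀ x : ZMod n, ∀ v : ι,
        (Pi.single (M := fun _ => ℂ) (x, v) 1 (k, u) : ℂ) =
          if x = k then (1 : Matrix ι ι ℂ) v u else 0 := by
      intro x v
      simp only [Pi.single_apply, Prod.mk.injEq, Matrix.one_apply, ite_and, eq_comm]
    simp only [h1, sub_mul, ite_mul, zero_mul, Finset.sum_sub_distrib, Finset.sum_ite_eq',
      Finset.mem_univ, if_true, Matrix.transpose_apply, incidence, Matrix.of_apply]
    simp only [Matrix.one_apply, Pi.single_apply, eq_comm (a := w), eq_comm (a := u)]
    ring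
  · rw [Finset.sum_comm]
    have hinner : ∀ v : ι, (∑ x : ZMod n, ∑ a : S v,
        (Pi.single (M := fun _ => ℂ) (x, v) 1 (k, u) -
          Pi.single (M := fun _ => ℂ) (x + ((a : ℕ) : ZMod n), v) 1 (k, u)) *
          ((ZMod.stdAddChar (x * j) : ℂ) * (1 : Matrix ι ι ℂ) v w -
            ZMod.stdAddChar ((x + ((a : ℕ) : ZMod n)) * j) * (1 : Matrix ι ι ℂ) v w)) =
        if v = u then ∑ a ∈ S v, ZMod.stdAddChar (k * j) * ((2 -
          (ZMod.stdAddChar ((a : ZMod n) * j) : ℂ) -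
          (ZMod.stdAddChar ((a : ZMod n) * j) : ℂ)⁻¹) * (1 : Matrix ι ι ℂ) v w) else 0 := by
      intro v
      by_cases hv : v = u
      · subst hv
        rw [if_pos rfl, Finset.sum_comm, ← Finset.sum_coe_sort (S v)]
        refine Finset.sum_congr rfl fun a _ => ?_
        simp only [Pi.single_apply, Prod.mk.injEq, and_true, eq_comm (a := k),
          ← eq_sub_iff_add_eq, Finset.sum_sub_distrib, sub_mul, ite_mul, one_mul, zero_mul,
          Finset.sum_ite_eq', Finset.mem_univ, if_true]
        have := stdAddChar_ne_zero (((a : ℕ) : ZMod n) * j)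
        simp only [sub_mul, add_mul, AddChar.map_add_eq_mul, AddChar.map_sub_eq_div]
        field_simp
        ring
      · simp [hv, Ne.symm hv]
    rw [Finset.sum_congr rfl fun v _ => hinner v, Finset.sum_ite_eq' Finset.univ u,
      if_pos (Finset.mem_univ _), ← Finset.mul_sum, ← Finset.sum_mul, Matrix.diagonal_apply,
      Matrix.one_apply]
    simp

/-- The all-ones matrix annihilates every nontrivial character, so it only alters the block j = 0.
-/
theorem det_foliation_laplacian_add (s t : κ → ι) (S : ι → Finset ℕ) :
    (incidence ℂ (foliationSource n s S) (foliationTarget n t S) *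
      (incidence ℂ (foliationSource n s S) (foliationTarget n t S)).transpose +
        Matrix.of fun _ _ => 1).det =
      (incidence ℂ s t * (incidence ℂ s t).transpose + Matrix.of fun _ _ => (n : ℂ)).det *
        ∏ j ∈ Finset.univ.erase (0 : ZMod n), (fiberBlock s t S j).det := by
  set M := incidence ℂ (foliationSource n s S) (foliationTarget n t S) *
      (incidence ℂ (foliationSource n s S) (foliationTarget n t S)).transpose +
        Matrix.of fun _ _ => 1 with hM
  set N : ZMod n → Matrix ι ι ℂ := fun j =>
    fiberBlock s t S j + Matrix.of fun _ _ => if j = 0 then (n : ℂ) else 0 with hN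
  have h0 : fiberBlock s t S (0 : ZMod n) = incidence ℂ s t * (incidence ℂ s t).transpose := by
    rw [fiberBlock]
    norm_num
  have hMK : M * fiberDFT n ι = fiberDFT n ι *
      (Matrix.blockDiagonal N).submatrix (Equiv.prodComm _ _) (Equiv.prodComm _ _) := by
    ext ⟨k, u⟩ ⟨j, w⟩
    rw [hM, Matrix.add_mul, Matrix.add_apply, foliation_laplacian_mul_fiberDFT]
    have h1 : ((Matrix.of fun _ _ => (1 : ℂ) : Matrix (ZMod n × ι) (ZMod n × ι) ℂ) *
        fiberDFT n ι) (k, u) (j, w) = if j = 0 then (n : ℂ) else 0 := by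
      rw [Matrix.mul_apply, Fintype.sum_prod_type]
      simp [fiberDFT, Matrix.one_apply, sum_stdAddChar_mul]
    have h2 : (fiberDFT n ι *
        (Matrix.blockDiagonal N).submatrix (Equiv.prodComm _ _) (Equiv.prodComm _ _))
          (k, u) (j, w) = ZMod.stdAddChar (k * j) * N j u w := by
      rw [Matrix.mul_apply, Fintype.sum_prod_type]
      simp [fiberDFT, Matrix.one_apply, Matrix.blockDiagonal_apply]
    rw [h1, h2]
    simp only [hN, Matrix.add_apply, mul_add, Matrix.of_apply]
    by_cases hj : j = 0
    · simp [hj]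
    · simp [hj]
  have hdet := congrArg Matrix.det hMK
  rw [Matrix.det_mul, Matrix.det_mul, Matrix.det_submatrix_equiv_self, Matrix.det_blockDiagonal,
    mul_comm] at hdet
  rw [mul_left_cancel₀ det_fiberDFT_ne_zero hdet,
    ← Finset.mul_prod_erase _ _ (Finset.mem_univ (0 : ZMod n))]
  congr 1
  · simp [hN, h0]
  · refine Finset.prod_congr rfl fun j hj => ?_
    have : N j = fiberBlock s t S j := by
      ext
      simp [hN, Finset.ne_of_mem_erase hj]
    rw [this]

/-- Since A J = 0, A + cJ = (A + J)(1 + ((c - 1)/m) J), and the second factor has determinant c. -/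
theorem det_laplacian_add_const [Nonempty ι] (s t : κ → ι) (c : ℂ) :
    (incidence ℂ s t * (incidence ℂ s t).transpose + Matrix.of fun _ _ => c).det =
      c * (incidence ℂ s t * (incidence ℂ s t).transpose + Matrix.of fun _ _ => 1).det := by
  set A := incidence ℂ s t * (incidence ℂ s t).transpose with hA
  have hm : (Fintype.card ι : ℂ) ≠ 0 := Nat.cast_ne_zero.2 Fintype.card_ne_zero
  have hAJ : ∀ x : ℂ, A * (Matrix.of fun _ _ => x) = 0 := by
    intro x
    ext u v
    rw [hA, Matrix.mul_assoc, incidence_mul_apply]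
    simp [transpose_incidence_mul]
  have hJ : (Matrix.of fun _ _ => (c - 1) / Fintype.card ι : Matrix ι ι ℂ) =
      Matrix.replicateCol Unit (fun _ => (c - 1) / Fintype.card ι) *
        Matrix.replicateRow Unit (fun _ => (1 : ℂ)) := by
    ext u v
    simp [Matrix.mul_apply]
  have hdet : (1 + (Matrix.of fun _ _ => (c - 1) / Fintype.card ι : Matrix ι ι ℂ)).det = c := by
    rw [hJ, Matrix.det_one_add_replicateCol_mul_replicateRow]
    simp only [dotProduct, one_mul, Finset.sum_const, Finset.card_univ, nsmul_eq_mul]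
    field_simp
    ring
  have hfac : (A + Matrix.of fun _ _ => 1) *
      (1 + (Matrix.of fun _ _ => (c - 1) / Fintype.card ι : Matrix ι ι ℂ)) =
      A + Matrix.of fun _ _ => c := by
    rw [Matrix.mul_add, Matrix.mul_one, Matrix.add_mul, hAJ, zero_add, add_assoc]
    congr 1
    ext u v
    simp only [Matrix.add_apply, Matrix.mul_apply, Matrix.of_apply, one_mul, Finset.sum_const,
      Finset.card_univ, nsmul_eq_mul]
    field_simp
    ring
  rw [← hfac, Matrix.det_mul, hdet, mul_comm]

end DFT

end Foliation

/-! ### The polynomial P and its values at 2 and -2 -/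

namespace Foliation

open Polynomial Matrix

section Base

theorem connects_univ {V E : Type*} {H : Graph V E} {s t : E(H) → V(H)}
    (hst : ∀ e : E(H), H.IsLink e (s e) (t e)) (hconn : H.toSimpleGraph.Connected) : Connects s t Set.univ := by
  have := hconn.nonempty
  refine (connected_iff_connects H (Equiv.refl _) (fun e : E(H) => (e : E)) s t Set.univ ?_
    fun e _ => hst e).1 hconn
  simp

variable {V E : Type*} [DecidableEq V] (H : Graph V E)

theorem genLaplacian_apply {R : Type*} [CommRing R] (x : V(H) → R) (u v : V(H)) :
    genLaplacian H x u v = (if u = v then x u else 0) - (edgeMult H u v : R) := by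
  simp [genLaplacian, Matrix.diagonal_apply]

theorem genLaplacian_add_diagonal {R : Type*} [CommRing R] (x y : V(H) → R) :
    genLaplacian H x + Matrix.diagonal y = genLaplacian H fun v => x v + y v := by
  ext u v
  by_cases h : u = v
  · subst h; simp [genLaplacian_apply]; ring
  · simp [genLaplacian_apply, h]

theorem map_genLaplacian {R R' : Type*} [CommRing R] [CommRing R'] (f : R →+* R') (x : V(H) → R) :
    (genLaplacian H x).map f = genLaplacian H fun v => f (x v) := by
  ext u v
  simp [genLaplacian_apply, apply_ite f]

variable [Fintype V(H)]

theorem map_det_genLaplacian {R R' : Type*} [CommRing R] [CommRing R'] (f : R →+* R')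
    (x : V(H) → R) : f (genLaplacian H x).det = (genLaplacian H fun v => f (x v)).det := by
  rw [RingHom.map_det, RingHom.mapMatrix_apply, map_genLaplacian]

/-- The rescaling of `chebyshevPoly` with `chebyshevPoly H S = (scaledPoly H S).comp (2 * X)`. -/
noncomputable def scaledPoly (S : V → Finset ℕ) : ℤ[X] :=
  (genLaplacian H fun v : V(H) =>
    (2 * ((S v).card : ℤ[X]) + (degree H (v : V) : ℤ[X]) - ∑ s ∈ S v, Chebyshev.C ℤ (s : ℤ))).det

theorem eval_chebyshevPoly_neg_one (S : V → Finset ℕ) :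
    (chebyshevPoly H S).eval (-1) = (scaledPoly H S).eval (-2) := by
  rw [← coe_evalRingHom, ← coe_evalRingHom, chebyshevPoly, scaledPoly, map_det_genLaplacian,
    map_det_genLaplacian]
  congr 2
  ext v
  simp [eval_finsetSum, Chebyshev.C_eval_neg_two]

theorem eval_scaledPoly_two (S : V → Finset ℕ) :
    (scaledPoly H S).eval 2 = (genLaplacian H fun v : V(H) => (degree H v : ℤ)).det := by
  rw [← coe_evalRingHom, scaledPoly, map_det_genLaplacian]
  congr 2
  ext v
  simp [eval_finsetSum, Chebyshev.C_eval_two]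
  ring

theorem eval_scaledPoly_neg_two (S : V → Finset ℕ) :
    (scaledPoly H S).eval (-2) = (genLaplacian H fun v : V(H) => (degree H v : ℤ) +
      ∑ s ∈ S v, (2 - 2 * (-1 : ℤ) ^ s)).det := by
  rw [← coe_evalRingHom, scaledPoly, map_det_genLaplacian]
  congr 2
  ext v
  simp [eval_finsetSum, Chebyshev.C_eval_neg_two, Finset.sum_sub_distrib, Int.negOnePow_def]
  ring

variable {H} [Fintype E(H)] {s t : E(H) → V(H)}

theorem laplacian_eq_genLaplacian (hst : ∀ e : E(H), H.IsLink e (s e) (t e))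
    (hloop : H.Loopless) :
    incidence ℤ s t * (incidence ℤ s t).transpose =
      genLaplacian H fun v : V(H) => (degree H v : ℤ) := by
  have hoff : ∀ u v : V(H), u ≠ v → (incidence ℤ s t * (incidence ℤ s t).transpose) u v =
      -(edgeMult H u v : ℤ) := by
    intro u v huv
    classical
    have hcard : edgeMult H (u : V) v =
        (Finset.univ.filter fun e : E(H) => H.IsLink e u v).card := by
      rw [edgeMult, ← Set.ncard_coe_finset, ← Set.ncard_image_of_injective _
        Subtype.val_injective]
      congr 1
      ext e
      simp only [Set.mem_ofPred_eq, Finset.coe_filter, Finset.mem_univ, true_and, Set.mem_image,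
        Subtype.exists, exists_and_right, exists_eq_right]
      exact ⟨fun h => ⟨h.edge_mem, h⟩, fun ⟨_, h⟩ => h⟩
    rw [hcard, Finset.card_filter, Matrix.mul_apply]
    push_cast
    rw [← Finset.sum_neg_distrib]
    refine Finset.sum_congr rfl fun e _ => ?_
    have hne : s e ≠ t e := fun h => (hst e).ne (congrArg Subtype.val h)
    rw [(hst e).isLink_iff]
    simp only [← Subtype.ext_iff, Matrix.transpose_apply, incidence, Matrix.of_apply,
      Pi.single_apply]
    by_cases h1 : u = s e
    · subst h1
      by_cases h2 : t e = v <;> simp [hne, hne.symm, huv, huv.symm, h2, eq_comm (a := v)]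
    · by_cases h2 : u = t e
      · subst h2
        by_cases h3 : s e = v <;> simp [hne, hne.symm, huv, huv.symm, h3, eq_comm (a := v)]
      · simp [h1, h2, Ne.symm h1, Ne.symm h2]
  have hself : ∀ u : V(H), edgeMult H (u : V) u = 0 := by
    intro u
    have : {e : E | H.IsLink e (u : V) u} = ∅ :=
      Set.eq_empty_of_forall_notMem fun e h => hloop.not_isLoopAt e u h
    rw [edgeMult, this, Set.ncard_empty]
  ext u v
  rw [genLaplacian_apply]
  by_cases huv : u = v
  · subst huv
    -- Rows of the Laplacian sum to zero, so its diagonal is determined by the off-diagonal entries.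
    have hrow : ∑ v, (incidence ℤ s t * (incidence ℤ s t).transpose) u v = 0 := by
      simp only [Matrix.mul_apply]
      rw [Finset.sum_comm]
      simp only [← Finset.mul_sum, Matrix.transpose_apply, sum_incidence, mul_zero,
        Finset.sum_const_zero]
    rw [← Finset.add_sum_erase _ _ (Finset.mem_univ u), Finset.sum_congr rfl fun v hv =>
      hoff u v (Finset.ne_of_mem_erase hv).symm] at hrow
    have hdeg : (degree H (u : V) : ℤ) = ∑ v ∈ Finset.univ.erase u, (edgeMult H (u : V) v : ℤ) := by
      rw [degree, ← Finset.add_sum_erase _ _ (Finset.mem_univ u), hself, zero_add]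
      push_cast
      rfl
    rw [if_pos rfl, hself, hdeg]
    rw [Finset.sum_neg_distrib] at hrow
    push_cast
    linarith
  · rw [hoff u v huv, if_neg huv]
    ring

theorem eval_scaledPoly_two_eq_zero (hst : ∀ e : E(H), H.IsLink e (s e) (t e))
    (hloop : H.Loopless) [Nonempty V(H)] (S : V → Finset ℕ) :
    (scaledPoly H S).eval 2 = 0 := by
  rw [eval_scaledPoly_two, ← laplacian_eq_genLaplacian hst hloop,
    ← Matrix.exists_vecMul_eq_zero_iff]
  refine ⟨1, one_ne_zero, ?_⟩
  rw [← Matrix.vecMul_vecMul]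
  have : (1 : V(H) → ℤ) ᵥ* incidence ℤ s t = 0 := by
    ext e
    simp [Matrix.vecMul, dotProduct, sum_incidence]
  rw [this, Matrix.zero_vecMul]

/-- With z the j-th root of unity, C_a(z + 1/z) = z^a + z^{-a}, so the block is the generalized
Laplacian defining P, evaluated at x_j. -/
theorem det_fiberBlock (hst : ∀ e : E(H), H.IsLink e (s e) (t e))
    (hloop : H.Loopless) (S : V → Finset ℕ) {n : ℕ} [NeZero n] (j : ZMod n) :
    (fiberBlock s t (fun v : V(H) => S v) j).det = aeval (cosNode j) (scaledPoly H S) := by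
  have h := map_laplacian (Int.castRingHom ℂ) s t
  rw [laplacian_eq_genLaplacian hst hloop, map_genLaplacian] at h
  rw [fiberBlock, ← h, genLaplacian_add_diagonal, scaledPoly, ← AlgHom.coe_toRingHom,
    map_det_genLaplacian]
  congr 2
  ext v
  have hC : ∀ a : ℕ, aeval (cosNode j) (Chebyshev.C ℤ (a : ℤ)) =
      (ZMod.stdAddChar ((a : ZMod n) * j) : ℂ) + (ZMod.stdAddChar ((a : ZMod n) * j) : ℂ)⁻¹ := by
    intro a
    rw [Chebyshev.aeval_C, cosNode, chebyshevC_eval_add_inv (stdAddChar_ne_zero j), inv_pow,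
      ← AddChar.map_nsmul_eq_pow, nsmul_eq_mul]
  have h2 : aeval (cosNode j) (2 : ℤ[X]) = 2 := map_ofNat _ 2
  simp [hC, h2, Finset.sum_sub_distrib, Finset.sum_add_distrib]
  ring

theorem complexity_base (hst : ∀ e : E(H), H.IsLink e (s e) (t e))
     [Nonempty V(H)] :
    (incidence ℤ s t * (incidence ℤ s t).transpose + Matrix.of fun _ _ => 1).det =
      (Fintype.card V(H) : ℤ) ^ 2 * (complexity H : ℤ) :=
  det_incidence_eq_complexity H (Equiv.refl _) (Equiv.refl _) s t hst

theorem complexity_foliation (hst : ∀ e : E(H), H.IsLink e (s e) (t e))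
     [Nonempty V(H)] (S : V → Finset ℕ) (n : ℕ) [NeZero n] :
    (incidence ℤ (foliationSource n s fun v : V(H) => S v)
        (foliationTarget n t fun v : V(H) => S v) *
      (incidence ℤ (foliationSource n s fun v : V(H) => S v)
        (foliationTarget n t fun v : V(H) => S v)).transpose + Matrix.of fun _ _ => 1).det =
      ((n : ℤ) * Fintype.card V(H)) ^ 2 * (complexity (foliation H S n) : ℤ) := by
  let φ : ZMod n × V(H) ≃ V(foliation H S n) :=
    { toFun := fun x => ⟨(x.1, x.2), x.2.2⟩
      invFun := fun x => (x.1.1, ⟨x.1.2, x.2⟩)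
      left_inv := fun x => rfl
      right_inv := fun x => rfl }
  let f : ZMod n × (E(H) ⊕ Σ v : V(H), S v) → ZMod n × (E ⊕ V × ℕ) :=
    fun x => (x.1, Sum.map (fun e : E(H) => (e : E))
      (fun a : Σ v : V(H), S v => ((a.1 : V), (a.2 : ℕ))) x.2)
  have hf : Function.Injective f := by
    refine Function.Injective.prodMap Function.injective_id
      (Function.Injective.sumMap Subtype.val_injective ?_)
    rintro ⟨v, a⟩ ⟨w, b⟩ h
    simp only [Prod.mk.injEq] at h
    obtain ⟨h1, h2⟩ := h
    have h1 := Subtype.ext h1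
    subst h1
    rw [Subtype.ext h2]
  have hlink : ∀ x, (foliation H S n).IsLink (f x)
      (φ (foliationSource n s (fun v : V(H) => S v) x))
      (φ (foliationTarget n t (fun v : V(H) => S v) x)) := by
    rintro ⟨k, e | ⟨v, a⟩⟩
    · exact ⟨rfl, rfl, hst e⟩
    · exact ⟨v.2, a.2, Or.inl ⟨rfl, rfl⟩⟩
  let ψ : ZMod n × (E(H) ⊕ Σ v : V(H), S v) ≃ E(foliation H S n) :=
    Equiv.ofBijective (fun x => ⟨f x, (hlink x).edge_mem⟩) ⟨fun x y h => hf (congrArg Subtype.val h),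
      by
        rintro ⟨⟨k, e | ⟨v, a⟩⟩, he⟩
        · obtain ⟨x, y, hxy⟩ := (Graph.edge_mem_iff_exists_isLink _ _).1 he
          exact ⟨(k, Sum.inl ⟨e, hxy.2.2.edge_mem⟩), rfl⟩
        · obtain ⟨x, y, hxy⟩ := (Graph.edge_mem_iff_exists_isLink _ _).1 he
          exact ⟨(k, Sum.inr ⟨⟨v, hxy.1⟩, ⟨a, hxy.2.1⟩⟩), rfl⟩⟩
  rw [det_incidence_eq_complexity (foliation H S n) φ ψ _ _ hlink, Fintype.card_prod, ZMod.card]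
  push_cast
  rfl

theorem natCast_mul_complexity_foliation (hst : ∀ e : E(H), H.IsLink e (s e) (t e))
    (hloop : H.Loopless) [Nonempty V(H)] (S : V → Finset ℕ)
    (n : ℕ) [NeZero n] :
    (n : ℂ) * (complexity (foliation H S n) : ℂ) = (complexity H : ℂ) *
      ∏ j ∈ Finset.univ.erase (0 : ZMod n), aeval (cosNode j) (scaledPoly H S) := by
  have key := det_foliation_laplacian_add (n := n) s t (fun v : V(H) => S v)
  rw [det_laplacian_add_const s t, Finset.prod_congr rfl fun j _ => det_fiberBlock hst hloop S j] at key
  have hm : (Fintype.card V(H) : ℂ) ≠ 0 := Nat.cast_ne_zero.2 Fintype.card_ne_zero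
  have hn : (n : ℂ) ≠ 0 := Nat.cast_ne_zero.2 (NeZero.ne n)
  rw [← map_det_laplacian_add_one (Int.castRingHom ℂ), complexity_foliation hst,
    ← map_det_laplacian_add_one (Int.castRingHom ℂ), complexity_base hst] at key
  simp only [eq_intCast, Int.cast_mul, Int.cast_pow, Int.cast_natCast] at key
  refine mul_left_cancel₀ (mul_ne_zero hn (pow_ne_zero 2 hm)) ?_
  linear_combination key

theorem eval_scaledPoly_neg_two_nonneg (hst : ∀ e : E(H), H.IsLink e (s e) (t e))
    (hloop : H.Loopless) (S : V → Finset ℕ) :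
    0 ≤ (scaledPoly H S).eval (-2) := by
  have hD : ∀ a : ℕ, 0 ≤ (2 - 2 * (-1 : ℝ) ^ a) := by
    intro a
    rcases neg_one_pow_eq_or ℝ a with h | h <;> rw [h] <;> norm_num
  have hmap := map_laplacian (Int.castRingHom ℝ) s t
  rw [laplacian_eq_genLaplacian hst hloop, map_genLaplacian] at hmap
  have hpos : ((incidence ℝ s t * (incidence ℝ s t).transpose) +
      Matrix.diagonal fun v : V(H) => ∑ a ∈ S v, (2 - 2 * (-1 : ℝ) ^ a)).PosSemidef := by
    refine Matrix.PosSemidef.add ?_ (Matrix.PosSemidef.diagonal fun v =>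
      Finset.sum_nonneg fun a _ => hD a)
    simpa using Matrix.posSemidef_self_mul_conjTranspose (incidence ℝ s t)
  have hdet := hpos.det_nonneg
  rw [← hmap, genLaplacian_add_diagonal] at hdet
  have : (((scaledPoly H S).eval (-2) : ℤ) : ℝ) =
      (genLaplacian H fun v : V(H) => (Int.castRingHom ℝ) (degree H v : ℤ) +
        ∑ a ∈ S v, (2 - 2 * (-1 : ℝ) ^ a)).det := by
    rw [eval_scaledPoly_neg_two, ← eq_intCast (Int.castRingHom ℝ), map_det_genLaplacian]
    congr 2
    ext v
    simp
  exact_mod_cast this ▸ hdet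

theorem eval_scaledPoly_neg_two_eq_zero_iff (hst : ∀ e : E(H), H.IsLink e (s e) (t e))
    (hloop : H.Loopless)
    (hconn : H.toSimpleGraph.Connected) (S : V → Finset ℕ) :
    (scaledPoly H S).eval (-2) = 0 ↔ ∀ v ∈ V(H), ∀ a ∈ S v, Even a := by
  have hne := hconn.nonempty
  have hD : ∀ a : ℕ, 0 ≤ (2 - 2 * (-1 : ℤ) ^ a) := by
    intro a
    rcases neg_one_pow_eq_or ℤ a with h | h <;> rw [h] <;> norm_num
  constructor
  · intro h
    rw [eval_scaledPoly_neg_two, ← genLaplacian_add_diagonal,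
      ← laplacian_eq_genLaplacian hst hloop, ← Matrix.exists_mulVec_eq_zero_iff] at h
    obtain ⟨x, hx0, hx⟩ := h
    set D : V(H) → ℤ := fun v => ∑ a ∈ S v, (2 - 2 * (-1 : ℤ) ^ a) with hDdef
    have hDnn : ∀ v, 0 ≤ D v := fun v => Finset.sum_nonneg fun a _ => hD a
    -- The quadratic form at a kernel vector x. Both sums are nonnegative, so both vanish: the first
    -- makes x constant by connectedness, the second then forces D = 0, that is, no odd jumps.
    have hquad : ∑ e, (x (s e) - x (t e)) ^ 2 + ∑ v, D v * x v ^ 2 = 0 := by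
      have h1 : x ⬝ᵥ ((incidence ℤ s t * (incidence ℤ s t).transpose) *ᵥ x) =
          ∑ e, (x (s e) - x (t e)) ^ 2 := by
        have h2 : ∀ e, (x ᵥ* incidence ℤ s t) e = x (s e) - x (t e) := by
          intro e
          simp [Matrix.vecMul, dotProduct, incidence, mul_sub, Pi.single_apply]
        rw [← Matrix.mulVec_mulVec, Matrix.dotProduct_mulVec, Matrix.mulVec_transpose]
        simp only [dotProduct, h2, sq]
      have h3 : x ⬝ᵥ (Matrix.diagonal D *ᵥ x) = ∑ v, D v * x v ^ 2 := by
        simp only [dotProduct, Matrix.mulVec_diagonal]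
        exact Finset.sum_congr rfl fun v _ => by ring
      rw [← h1, ← h3, ← dotProduct_add, ← Matrix.add_mulVec, hx, dotProduct_zero]
    have hn1 : 0 ≤ ∑ e, (x (s e) - x (t e)) ^ 2 := Finset.sum_nonneg fun e _ => sq_nonneg _
    have hn2 : 0 ≤ ∑ v, D v * x v ^ 2 :=
      Finset.sum_nonneg fun v _ => mul_nonneg (hDnn v) (sq_nonneg _)
    have hz1 : ∑ e, (x (s e) - x (t e)) ^ 2 = 0 := by linarith
    have hz2 : ∑ v, D v * x v ^ 2 = 0 := by linarith
    rw [Finset.sum_eq_zero_iff_of_nonneg fun e _ => sq_nonneg _] at hz1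
    rw [Finset.sum_eq_zero_iff_of_nonneg fun v _ => mul_nonneg (hDnn v) (sq_nonneg _)] at hz2
    have hconst : ∀ u v, x u = x v := by
      intro u v
      induction connects_univ hst hconn u v with
      | rel u v h =>
        obtain ⟨e, -, rfl, rfl⟩ := h
        exact sub_eq_zero.1 (pow_eq_zero_iff two_ne_zero |>.1 (hz1 e (Finset.mem_univ _)))
      | refl u => rfl
      | symm u v _ ih => exact ih.symm
      | trans u v w _ _ ih1 ih2 => exact ih1.trans ih2
    have hxne : ∀ v, x v ≠ 0 := fun v hv => hx0 (funext fun u => (hconst u v).trans hv)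
    intro v hv a ha
    have hDv : D ⟨v, hv⟩ = 0 := by
      have := hz2 ⟨v, hv⟩ (Finset.mem_univ _)
      exact (mul_eq_zero.1 this).resolve_right (pow_ne_zero _ (hxne _))
    rw [hDdef, Finset.sum_eq_zero_iff_of_nonneg fun a _ => hD a] at hDv
    by_contra hodd
    have := hDv a ha
    rw [(Nat.not_even_iff_odd.1 hodd).neg_one_pow] at this
    norm_num at this
  · intro h
    -- For even jumps the added diagonal vanishes, so P(-2) = P(2).
    rw [← eval_scaledPoly_two_eq_zero hst hloop S, eval_scaledPoly_neg_two, eval_scaledPoly_two]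
    congr 2
    ext v
    rw [Finset.sum_eq_zero, add_zero]
    intro a ha
    rw [(h v v.2 a ha).neg_one_pow]
    norm_num

end Base

end Foliation

/-! ### Arithmetic of the square-free part -/

theorem theorem2 {V E : Type*} [DecidableEq V] (H : Graph V E) [Fintype V(H)]
    (hE : E(H).Finite) (hloop : H.Loopless) (hconn : H.toSimpleGraph.Connected)
    (S : V → Finset ℕ) (hS : ∀ v ∈ V(H), ∀ s ∈ S v, 1 ≤ s) :
    0 ≤ (Foliation.chebyshevPoly H S).eval (-1) ∧
    ((Foliation.chebyshevPoly H S).eval (-1) = 0 ↔ ∀ v ∈ V(H), ∀ s ∈ S v, Even s) ∧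
    ∀ p : ℕ, Squarefree p →
      (∃ r : ℕ, (Foliation.chebyshevPoly H S).eval (-1) = (p : ℤ) * (r : ℤ) ^ 2) →
      ∃ a : ℕ → ℤ, ∀ n : ℕ, 1 ≤ n →
        (Odd n →
          (Foliation.complexity (Foliation.foliation H S n) : ℤ) =
            (n : ℤ) * (Foliation.complexity H : ℤ) * a n ^ 2) ∧
        (Even n →
          (Foliation.complexity (Foliation.foliation H S n) : ℤ) =
            (p : ℤ) * (n : ℤ) * (Foliation.complexity H : ℤ) * a n ^ 2) := by
  have : Fintype E(H) := hE.fintype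
  have hne := hconn.nonempty
  have hends : ∀ e : E(H), ∃ x y : V(H), H.IsLink e x y := by
    intro e
    obtain ⟨x, y, h⟩ := Graph.exists_isLink_of_mem_edgeSet e.2
    exact ⟨⟨x, h.left_mem⟩, ⟨y, h.right_mem⟩, h⟩
  choose s t hst using hends
  rw [Foliation.eval_chebyshevPoly_neg_one]
  refine ⟨Foliation.eval_scaledPoly_neg_two_nonneg hst hloop S,
    Foliation.eval_scaledPoly_neg_two_eq_zero_iff hst hloop hconn S, ?_⟩
  rintro p hp ⟨r, hr⟩
  obtain ⟨g, hg⟩ := Polynomial.dvd_iff_isRoot.2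
    (Foliation.eval_scaledPoly_two_eq_zero hst hloop S)
  have hg' : Foliation.scaledPoly H S = (Polynomial.X - 2) * g := hg
  have hgr : (p : ℤ) * (r : ℤ) ^ 2 = -4 * g.eval (-2) := by
    rw [← hr, hg', Polynomial.eval_mul, Polynomial.eval_sub, Polynomial.eval_X,
      Polynomial.eval_ofNat]
    norm_num
  -- From 4 ∣ p r²: if r were odd, then 4 ∣ p, contradicting square-freeness. Halving r absorbs the
  -- factor 4 in P(-2) = -4g(-2).
  have hreven : Even r := by
    by_contra hodd
    rw [Nat.not_even_iff_odd] at hodd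
    have h4 : 4 ∣ p * r ^ 2 := by
      have : (4 : ℤ) ∣ ((p * r ^ 2 : ℕ) : ℤ) := ⟨-g.eval (-2), by push_cast; linarith⟩
      exact_mod_cast this
    have hcop : Nat.Coprime 4 (r ^ 2) :=
      Nat.Coprime.pow_right 2 (Nat.Coprime.pow_left 2 (Nat.coprime_two_left.2 hodd))
    have h22 : 2 * 2 ∣ p := hcop.dvd_of_dvd_mul_right h4
    exact absurd (hp 2 h22) (by decide)
  obtain ⟨q, rfl⟩ := hreven.two_dvd
  have hgq : -g.eval (-2) = p * q ^ 2 := by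
    push_cast at hgr
    linarith
  have main : ∀ n : ℕ, ∃ a : ℤ, 1 ≤ n →
        (Odd n →
          (Foliation.complexity (Foliation.foliation H S n) : ℤ) =
            (n : ℤ) * (Foliation.complexity H : ℤ) * a ^ 2) ∧
        (Even n →
          (Foliation.complexity (Foliation.foliation H S n) : ℤ) =
            (p : ℤ) * (n : ℤ) * (Foliation.complexity H : ℤ) * a ^ 2) := by
    intro n
    rcases Nat.eq_zero_or_pos n with rfl | hn
    · exact ⟨0, fun h => absurd h (by norm_num)⟩
    have : NeZero n := ⟨hn.ne'⟩
    have hnC : (n : ℂ) ≠ 0 := Nat.cast_ne_zero.2 hn.ne'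
    have key := Foliation.natCast_mul_complexity_foliation hst hloop S n
    rw [hg'] at key
    rcases Nat.even_or_odd n with heven | hodd
    · obtain ⟨N, hN⟩ := Foliation.prod_aeval_cosNode_even heven g
      -- N is the resultant factor, and q comes from -g(-2) = p q², which also cancels the minus
      -- sign of the even product.
      refine ⟨q * N, fun _ => ⟨fun h => absurd heven (Nat.not_even_iff_odd.2 h), fun _ => ?_⟩⟩
      rw [hN] at key
      have hgC : -((g.eval (-2) : ℤ) : ℂ) = p * q ^ 2 := by exact_mod_cast hgq
      have : (Foliation.complexity (Foliation.foliation H S n) : ℂ) =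
          p * n * Foliation.complexity H * (q * N) ^ 2 := by
        refine mul_left_cancel₀ hnC ?_
        rw [key]
        linear_combination (Foliation.complexity H * (n : ℂ) ^ 2 * (N : ℂ) ^ 2) * hgC
      exact_mod_cast this
    · obtain ⟨N, hN⟩ := Foliation.prod_aeval_cosNode_odd hodd g
      refine ⟨N, fun _ => ⟨fun _ => ?_, fun h => absurd h (Nat.not_even_iff_odd.2 hodd)⟩⟩
      rw [hN] at key
      have : (Foliation.complexity (Foliation.foliation H S n) : ℂ) =
          n * Foliation.complexity H * N ^ 2 := by
        refine mul_left_cancel₀ hnC ?_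
        rw [key]
        ring
      exact_mod_cast this
  choose a ha using main
  exact ⟨a, ha⟩
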